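/- Let $p$ be a prime and let $G$ be a group of order $p^5$ whose nilpotence class is at least $3$. For a complex irreducible character $\chi$ of $G$, let $\ker\chi=\{g\in G : \chi(g)=\chi(1)\}$ and let the codegree of $\chi$ be $\operatorname{cod}(\chi)=|G:\ker\chi|/\chi(1)$; let $\operatorname{cod}(G)=\{\operatorname{cod}(\chi) : \chi\in\operatorname{Irr}(G)\}$ be the set of codegrees of the complex irreducible characters of $G$. Then $p^2\in\operatorname{cod}(G)$. -/

import Mathlib

noncomputable section

/-- `Irr(G)`: the set of complex irreducible characters of `G`, as functions `G → ℂ`. -/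
def Irr (G : Type*) [Group G] : Set (G → ℂ) :=
  {χ | ∃ (V : Type) (_ : AddCommGroup V) (_ : Module ℂ V) (_ : FiniteDimensional ℂ V)
      (ρ : Representation ℂ G V), ρ.IsIrreducible ∧ ρ.character = χ}

/-- The kernel `{g | χ g = χ 1}` of a character `χ`, as a subgroup. It is written as the subgroup
generated by this set so that it makes sense for every function `χ`; for a character of a finite
group the set is already a subgroup, namely the kernel of any representation affording `χ`
(see `characterKer_eq_ker` and `coe_characterKer`). -/
def characterKer {G : Type*} [Group G] (χ : G → ℂ) : Subgroup G :=
  Subgroup.closure {g | χ g = χ 1}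

/-- The codegree `|G : ker χ| / χ(1)`. -/
def codegree {G : Type*} [Group G] (χ : G → ℂ) : ℂ :=
  ((characterKer χ).index : ℂ) / χ 1

/-- `cod(G)`: the set of codegrees of the irreducible characters of `G`. -/
def cod (G : Type*) [Group G] : Set ℂ :=
  codegree '' Irr G

theorem character_eq_iff_apply_eq_one {G : Type*} [Group G] [Finite G] {V : Type*} [AddCommGroup V]
    [Module ℂ V] [FiniteDimensional ℂ V] (ρ : Representation ℂ G V) (g : G) :
    ρ.character g = ρ.character 1 ↔ ρ g = 1 := by
  refine ⟨fun h => ?_, fun h => by simp [Representation.character, h]⟩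
  have hm : 0 < orderOf g := orderOf_pos g
  have hT : (ρ g) ^ orderOf g = 1 := by rw [← map_pow, pow_orderOf_eq_one, map_one]
  have hroot : ∀ z ∈ (ρ g).charpoly.roots, ‖z‖ = 1 := by
    intro z hz
    have hz' : Module.End.HasEigenvalue (ρ g) z := by
      rw [Module.End.hasEigenvalue_iff_isRoot_charpoly]
      exact Polynomial.isRoot_of_mem_roots hz
    obtain ⟨v, hv⟩ := hz'.exists_hasEigenvector
    have h1 := hv.pow_apply (orderOf g)
    rw [hT, Module.End.one_apply] at h1
    have h2 : z ^ orderOf g = 1 := by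
      have h3 : (1 - z ^ orderOf g) • v = 0 := by rw [sub_smul, one_smul, ← h1, sub_self]
      rcases smul_eq_zero.1 h3 with h4 | h4
      · exact (sub_eq_zero.1 h4).symm
      · exact absurd h4 hv.2
    exact Complex.norm_eq_one_of_pow_eq_one h2 hm.ne'
  have hsplit : (ρ g).charpoly.Splits := IsAlgClosed.splits _
  have hcard : (ρ g).charpoly.roots.card = Module.finrank ℂ V := by
    rw [← (ρ g).charpoly_natDegree, hsplit.natDegree_eq_card_roots]
  have htr : (ρ g).charpoly.roots.sum = (Module.finrank ℂ V : ℂ) := by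
    rw [← Module.End.trace_eq_sum_roots_charpoly_of_splits hsplit]
    simpa [Representation.character] using h
  have hone : ∀ z ∈ (ρ g).charpoly.roots, z = 1 := by
    have hre : ((ρ g).charpoly.roots.map (fun z => 1 - z.re)).sum = 0 := by
      have h5 : ((ρ g).charpoly.roots.map Complex.re).sum = (Module.finrank ℂ V : ℝ) := by
        have := congrArg Complex.re htr
        rw [Complex.natCast_re] at this
        rw [← this]
        exact (map_multiset_sum Complex.reAddGroupHom _).symm
      rw [Multiset.sum_map_sub, h5]
      simp [hcard]
    intro z hz
    have hnn : ∀ x ∈ (ρ g).charpoly.roots.map (fun z => 1 - z.re), 0 ≤ x := by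
      intro x hx
      obtain ⟨w, hw, rfl⟩ := Multiset.mem_map.1 hx
      have := Complex.re_le_norm w
      rw [hroot w hw] at this
      linarith
    have h6 : 1 - z.re = 0 :=
      Multiset.all_zero_of_le_zero_le_of_sum_eq_zero hnn hre _
        (Multiset.mem_map_of_mem _ hz)
    have h7 : z.re = 1 := by linarith
    have h8 := Complex.sq_norm z
    rw [hroot z hz, Complex.normSq_apply, h7] at h8
    have h9 : z.im = 0 := by nlinarith
    exact Complex.ext (by simpa using h7) (by simpa using h9)
  have hpoly : (ρ g).charpoly = (Polynomial.X - Polynomial.C 1) ^ Module.finrank ℂ V := by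
    rw [hsplit.eq_prod_roots_of_monic (LinearMap.charpoly_monic _),
      Multiset.eq_replicate.2 ⟨hcard, hone⟩]
    simp
  have hnil : IsNilpotent (ρ g - 1) := by
    refine ⟨Module.finrank ℂ V, ?_⟩
    have := LinearMap.aeval_self_charpoly (ρ g)
    rw [hpoly] at this
    simpa using this
  have hss : Module.End.IsSemisimple (ρ g) := by
    refine Module.End.isSemisimple_of_squarefree_aeval_eq_zero
      (p := Polynomial.X ^ orderOf g - 1) ?_ (by simp [hT])
    refine (Polynomial.separable_X_pow_sub_C (1 : ℂ) ?_ one_ne_zero).squarefree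
    exact_mod_cast hm.ne'
  have hss' : Module.End.IsSemisimple (ρ g - 1) := by
    have := Module.End.isSemisimple_sub_algebraMap_iff (f := ρ g) (μ := (1 : ℂ))
    simpa using this.2 hss
  exact sub_eq_zero.1 (Module.End.eq_zero_of_isNilpotent_isSemisimple hnil hss')

theorem characterKer_eq_ker {G : Type*} [Group G] [Finite G] {V : Type*} [AddCommGroup V]
    [Module ℂ V] [FiniteDimensional ℂ V] (ρ : Representation ℂ G V) :
    characterKer ρ.character = MonoidHom.ker ρ := by
  have : {g | ρ.character g = ρ.character 1} = (MonoidHom.ker ρ : Set G) := by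
    ext g
    exact character_eq_iff_apply_eq_one ρ g
  rw [characterKer, this, Subgroup.closure_eq]

theorem coe_characterKer {G : Type*} [Group G] [Finite G] {χ : G → ℂ} (hχ : χ ∈ Irr G) :
    (characterKer χ : Set G) = {g | χ g = χ 1} := by
  obtain ⟨V, _, _, _, ρ, -, rfl⟩ := hχ
  rw [characterKer_eq_ker]
  ext g
  exact (character_eq_iff_apply_eq_one ρ g).symm

end

/-! It is enough to find a normal subgroup N of order p² not containing G'. Then G/N is nonabelian
of order p³, so it has a faithful irreducible character of degree p and codegree p³/p = p²;
inflation to G keeps the codegree.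

Class at least 3 means that G' is not central, and `exists_normal_not_commutator_le` then gives N.
If every normal subgroup of order p² contained G', then |Z(G)| = p, and every central subgroup of
order p in G/Z(G) would contain (G/Z(G))'. Two such subgroups with trivial intersection force G' ≤
Z(G), a contradiction. They exist because a group of order p⁴ with derived subgroup of order at most
p has center of order at least p². -/

namespace Representation

open Module
open scoped commutatorElement

variable {G V : Type*} [Group G] [AddCommGroup V] [Module ℂ V]

/-! ### Irreducible complex representations -/

theorem IsIrreducible.eq_top_of_invariant {ρ : Representation ℂ G V} (hρ : ρ.IsIrreducible)
    (W : Submodule ℂ V) (hW : ∀ g, ∀ v ∈ W, ρ g v ∈ W) {v : V} (hv : v ∈ W) (hv0 : v ≠ 0) :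
    W = ⊤ := by
  rcases hρ.eq_bot_or_eq_top ⟨W, fun g v hv => hW g v hv⟩ with h | h
  · have : W = ⊥ := congrArg Subrepresentation.toSubmodule h
    rw [this, Submodule.mem_bot] at hv
    exact absurd hv hv0
  · exact congrArg Subrepresentation.toSubmodule h

theorem isIrreducible_of_forall_invariant [Nontrivial V] {ρ : Representation ℂ G V}
    (h : ∀ W : Submodule ℂ V, (∀ g, ∀ v ∈ W, ρ g v ∈ W) → W = ⊥ ∨ W = ⊤) :
    ρ.IsIrreducible where
  exists_pair_ne := ⟨⊥, ⊤, fun h => bot_ne_top (α := Submodule ℂ V)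
    (congrArg Subrepresentation.toSubmodule h)⟩
  eq_bot_or_eq_top W := (h W.toSubmodule fun g _ hv => W.apply_mem_toSubmodule g hv).imp
    (fun h => Subrepresentation.toSubmodule_injective h)
    (fun h => Subrepresentation.toSubmodule_injective h)

theorem IsIrreducible.nontrivial {ρ : Representation ℂ G V} (hρ : ρ.IsIrreducible) :
    Nontrivial V := by
  by_contra h
  rw [not_nontrivial_iff_subsingleton] at h
  obtain ⟨x, y, hxy⟩ := hρ.exists_pair_ne
  exact hxy (Subrepresentation.toSubmodule_injective (Subsingleton.elim _ _))

theorem IsIrreducible.comp_of_surjective {H : Type*} [Group H] {ρ : Representation ℂ G V}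
    (hρ : ρ.IsIrreducible) {f : H →* G} (hf : Function.Surjective f) :
    IsIrreducible (ρ.comp f : Representation ℂ H V) := by
  have := hρ.nontrivial
  refine isIrreducible_of_forall_invariant fun W hW => or_iff_not_imp_left.2 fun hbot => ?_
  obtain ⟨v, hv, hv0⟩ := W.exists_mem_ne_zero_of_ne_bot hbot
  refine hρ.eq_top_of_invariant W (fun g w hw => ?_) hv hv0
  obtain ⟨h, rfl⟩ := hf g
  exact hW h w hw

/-- **Schur's lemma** for central elements. -/
theorem IsIrreducible.exists_eq_smul_of_mem_center [FiniteDimensional ℂ V]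
    {ρ : Representation ℂ G V} (hρ : ρ.IsIrreducible) {c : G} (hc : c ∈ Subgroup.center G) :
    ∃ μ : ℂ, ∀ v, ρ c v = μ • v := by
  have := hρ.nontrivial
  obtain ⟨μ, hμ⟩ := Module.End.exists_eigenvalue (ρ c)
  obtain ⟨v, hv⟩ := hμ.exists_hasEigenvector
  refine ⟨μ, fun w => ?_⟩
  have htop := hρ.eq_top_of_invariant (Module.End.eigenspace (ρ c) μ) (fun g w hw => ?_) hv.1 hv.2
  · exact Module.End.mem_eigenspace_iff.1 (htop ▸ Submodule.mem_top)
  · rw [Module.End.mem_eigenspace_iff] at hw ⊢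
    rw [← Module.End.mul_apply, ← map_mul, ← Subgroup.mem_center_iff.1 hc g, map_mul,
      Module.End.mul_apply, hw, map_smul]

/-- Since A preserves the line of v, each ρ g v is a multiple of the translate of v by a coset
representative, so these translates span an invariant subspace. -/
theorem IsIrreducible.finrank_le_index [Finite G] {ρ : Representation ℂ G V}
    (hρ : ρ.IsIrreducible) {v : V} (hv : v ≠ 0) {A : Subgroup G}
    (hA : ∀ a ∈ A, ∃ μ : ℂ, ρ a v = μ • v) : finrank ℂ V ≤ A.index := by
  have := Fintype.ofFinite (G ⧸ A)
  let b : G ⧸ A → V := fun q => ρ q.out v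
  have hmem : ∀ g, ρ g v ∈ Submodule.span ℂ (Set.range b) := by
    intro g
    obtain ⟨a, ha⟩ := QuotientGroup.mk_out_eq_mul A g
    obtain ⟨μ, hμ⟩ := hA (a⁻¹ : A) (a⁻¹).2
    have : g = (g : G ⧸ A).out * (a⁻¹ : A) := by rw [ha]; simp
    rw [this, map_mul, Module.End.mul_apply, hμ, map_smul]
    exact Submodule.smul_mem _ _ (Submodule.subset_span ⟨_, rfl⟩)
  have htop := hρ.eq_top_of_invariant (Submodule.span ℂ (Set.range b)) (fun g w hw => ?_)
    (hmem 1) (by simpa using hv)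
  · have := finrank_range_le_card (R := ℂ) b
    rwa [Set.finrank, htop, finrank_top, ← Nat.card_eq_fintype_card] at this
  · induction hw using Submodule.span_induction with
    | mem x hx =>
      obtain ⟨q, rfl⟩ := hx
      rw [← Module.End.mul_apply, ← map_mul]
      exact hmem _
    | zero => simp
    | add x y _ _ hx hy => rw [map_add]; exact add_mem hx hy
    | smul a x _ hx => rw [map_smul]; exact Submodule.smul_mem _ _ hx

/-- If the commutator of two elements acts as a primitive `p`-th root of unity, then `p` divides
the degree: compare determinants. -/
theorem dvd_finrank_of_commutator_eq_smul [FiniteDimensional ℂ V] {ρ : Representation ℂ G V}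
    {p : ℕ} [Fact p.Prime] {x y : G} {μ : ℂ} (h : ∀ v, ρ ⁅x, y⁆ v = μ • v) (hp : μ ^ p = 1)
    (h1 : μ ≠ 1) : p ∣ finrank ℂ V := by
  have hdet : LinearMap.det (ρ ⁅x, y⁆) = 1 := by
    let d : G →* ℂ := (LinearMap.det : (V →ₗ[ℂ] V) →* ℂ).comp ρ
    change d ⁅x, y⁆ = 1
    have hx : d x * d x⁻¹ = 1 := by rw [← map_mul, mul_inv_cancel, map_one]
    have hy : d y * d y⁻¹ = 1 := by rw [← map_mul, mul_inv_cancel, map_one]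
    rw [commutatorElement_def, map_mul, map_mul, map_mul]
    linear_combination d y * d y⁻¹ * hx + hy
  have hs : ρ ⁅x, y⁆ = μ • (1 : V →ₗ[ℂ] V) := LinearMap.ext h
  rw [hs, LinearMap.det_smul, map_one, mul_one] at hdet
  rw [← orderOf_eq_prime hp h1]
  exact orderOf_dvd_of_pow_eq_one hdet

/-- Induction on the dimension through Maschke: c cannot act trivially on both an invariant subspace
and its invariant complement. -/
theorem exists_isIrreducible_apply_ne_one_of_finrank [Finite G] (c : G) (n : ℕ) :
    ∀ (V : Type) [AddCommGroup V] [Module ℂ V] [FiniteDimensional ℂ V]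
      (ρ : Representation ℂ G V), finrank ℂ V = n → ρ c ≠ 1 →
    ∃ (W : Type) (_ : AddCommGroup W) (_ : Module ℂ W) (_ : FiniteDimensional ℂ W)
      (σ : Representation ℂ G W), σ.IsIrreducible ∧ σ c ≠ 1 := by
  induction n using Nat.strong_induction_on with
  | _ n ih =>
  intro V _ _ _ ρ hn hc
  have : Nontrivial V := by
    by_contra h
    rw [not_nontrivial_iff_subsingleton] at h
    exact hc (Subsingleton.elim _ _)
  by_cases hirr : ρ.IsIrreducible
  · exact ⟨V, _, _, inferInstance, ρ, hirr, hc⟩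
  have hW : ∃ W : Subrepresentation ρ, W ≠ ⊥ ∧ W ≠ ⊤ := by
    by_contra! h
    refine hirr (isIrreducible_of_forall_invariant fun W hW => or_iff_not_imp_left.2 fun hb => ?_)
    exact congrArg Subrepresentation.toSubmodule
      (h ⟨W, fun g v hv => hW g v hv⟩ fun h => hb (congrArg Subrepresentation.toSubmodule h))
  obtain ⟨W, hbot, htop⟩ := hW
  obtain ⟨U, hU⟩ := exists_isCompl W
  have hUtop : U ≠ ⊤ := fun h => hbot (by simpa [h] using hU.disjoint)
  have key : ∀ S : Subrepresentation ρ, S ≠ ⊤ → (∃ v ∈ S.toSubmodule, ρ c v ≠ v) →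
      ∃ (W : Type) (_ : AddCommGroup W) (_ : Module ℂ W) (_ : FiniteDimensional ℂ W)
        (σ : Representation ℂ G W), σ.IsIrreducible ∧ σ c ≠ 1 := by
    rintro S hS ⟨v, hv, hne⟩
    refine ih (finrank ℂ S.toSubmodule) (hn ▸ Submodule.finrank_lt fun h =>
      hS (Subrepresentation.toSubmodule_injective h)) S.toSubmodule S.toRepresentation rfl
      fun h => hne ?_
    exact congrArg Subtype.val (LinearMap.congr_fun h ⟨v, hv⟩)
  by_cases h1 : ∃ v ∈ W.toSubmodule, ρ c v ≠ v
  · exact key W htop h1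
  by_cases h2 : ∃ v ∈ U.toSubmodule, ρ c v ≠ v
  · exact key U hUtop h2
  push Not at h1 h2
  refine absurd (LinearMap.ext fun v => ?_) hc
  have hv : v ∈ W.toSubmodule ⊔ U.toSubmodule := by
    have h := congrArg Subrepresentation.toSubmodule hU.sup_eq_top
    rw [Subrepresentation.toSubmodule_sup] at h
    rw [h]
    exact Submodule.mem_top
  obtain ⟨w, hw, u, hu, rfl⟩ := Submodule.mem_sup.1 hv
  rw [map_add, h1 w hw, h2 u hu, Module.End.one_apply]

theorem exists_isIrreducible_apply_ne_one [Finite G] {c : G} (hc : c ≠ 1) :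
    ∃ (W : Type) (_ : AddCommGroup W) (_ : Module ℂ W) (_ : FiniteDimensional ℂ W)
      (σ : Representation ℂ G W), σ.IsIrreducible ∧ σ c ≠ 1 := by
  classical
  obtain ⟨n, ⟨e⟩⟩ := Finite.exists_equiv_fin G
  -- The regular representation, carried over to `Fin n` so that its space lies in `Type`, as `Irr`
  -- requires.
  let ρ : Representation ℂ G (Fin n → ℂ) :=
    { toFun g := LinearMap.funLeft ℂ ℂ fun i => e (g⁻¹ * e.symm i)
      map_one' := by ext; simp [LinearMap.funLeft_apply]
      map_mul' g h := by ext; simp [LinearMap.funLeft_apply, mul_assoc] }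
  refine exists_isIrreducible_apply_ne_one_of_finrank c _ _ ρ rfl fun h => hc ?_
  have := congrFun (LinearMap.congr_fun h (Pi.single (e 1) 1)) (e c)
  by_contra hne
  simp [ρ, LinearMap.funLeft_apply, hne] at this

end Representation

/-! ### Codegrees and inflation -/

theorem Representation.IsIrreducible.index_ker_div_finrank_mem_cod {G : Type*} [Group G] [Finite G]
    {V : Type} [AddCommGroup V] [Module ℂ V] [FiniteDimensional ℂ V] {ρ : Representation ℂ G V}
    (hρ : ρ.IsIrreducible) : ((MonoidHom.ker ρ).index : ℂ) / Module.finrank ℂ V ∈ cod G := by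
  refine ⟨ρ.character, ⟨V, _, _, inferInstance, ρ, hρ, rfl⟩, ?_⟩
  rw [codegree, characterKer_eq_ker, Representation.char_one]

theorem cod_subset_of_surjective {G H : Type*} [Group G] [Group H] [Finite G] {f : G →* H}
    (hf : Function.Surjective f) : cod H ⊆ cod G := by
  have := Finite.of_surjective f hf
  rintro _ ⟨_, ⟨V, _, _, _, ρ, hρ, rfl⟩, rfl⟩
  have := (hρ.comp_of_surjective hf).index_ker_div_finrank_mem_cod
  rw [codegree, characterKer_eq_ker, Representation.char_one]
  convert this using 3
  exact (Subgroup.index_comap_of_surjective (MonoidHom.ker ρ) hf).symm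

/-! ### Counting in finite groups and p-groups -/

open scoped commutatorElement

theorem Subgroup.normal_of_le_center {G : Type*} [Group G] {N : Subgroup G}
    (h : N ≤ Subgroup.center G) : N.Normal where
  conj_mem n hn g := by
    rwa [Subgroup.mem_center_iff.1 (h hn) g, mul_inv_cancel_right]

theorem Subgroup.card_comap_mk' {G : Type*} [Group G] [Finite G] (N : Subgroup G) [N.Normal]
    (S : Subgroup (G ⧸ N)) :
    Nat.card (S.comap (QuotientGroup.mk' N)) = Nat.card N * Nat.card S := by
  have h1 := (S.comap (QuotientGroup.mk' N)).card_mul_index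
  rw [Subgroup.index_comap_of_surjective S (QuotientGroup.mk'_surjective N)] at h1
  have h2 := S.card_mul_index
  have h3 := N.card_mul_index
  rw [Subgroup.index_eq_card N, ← h2, ← mul_assoc, ← h1] at h3
  exact (Nat.eq_of_mul_eq_mul_right (Nat.pos_of_ne_zero S.index_ne_zero_of_finite) h3).symm

/-- The map g ↦ ⁅g, x⁆ separates left cosets of the centralizer of x. -/
theorem Subgroup.index_centralizer_singleton_le {G : Type*} [Group G] [Finite G] (x : G) :
    (Subgroup.centralizer {x}).index ≤ Nat.card (_root_.commutator G) := by
  rw [Subgroup.index_eq_card]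
  refine Nat.card_le_card_of_injective (fun q : G ⧸ Subgroup.centralizer {x} =>
    (⟨⁅q.out, x⁆, Subgroup.commutator_mem_commutator (Subgroup.mem_top _) (Subgroup.mem_top _)⟩ :
      _root_.commutator G)) fun q r h => ?_
  have h' : q.out * x * q.out⁻¹ = r.out * x * r.out⁻¹ :=
    mul_right_cancel (congrArg Subtype.val h)
  rw [← q.out_eq', ← r.out_eq']
  refine QuotientGroup.eq.2 (Subgroup.mem_centralizer_singleton_iff.2 ?_)
  have h'' : q.out * x = r.out * x * r.out⁻¹ * q.out := by rw [← h']; group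
  calc q.out⁻¹ * r.out * x = q.out⁻¹ * (r.out * x * r.out⁻¹ * q.out) * (q.out⁻¹ * r.out) := by group
    _ = x * (q.out⁻¹ * r.out) := by rw [← h'']; group

namespace IsPGroup

variable {p : ℕ} [Fact p.Prime] {G : Type*} [Group G] [Finite G]

theorem prime_le_card (hG : IsPGroup p G) [Nontrivial G] : p ≤ Nat.card G :=
  Nat.le_of_dvd Nat.card_pos (hG.card_eq_or_dvd.resolve_left Finite.one_lt_card.ne')

theorem prime_mul_card_le_of_lt (hG : IsPGroup p G) {H K : Subgroup G} (h : H < K) :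
    p * Nat.card H ≤ Nat.card K := by
  obtain ⟨m, hm⟩ := IsPGroup.iff_card.1 (hG.to_subgroup H)
  obtain ⟨n, hn⟩ := IsPGroup.iff_card.1 (hG.to_subgroup K)
  have hlt : Nat.card H < Nat.card K := by
    by_contra! hle
    exact h.ne (Subgroup.eq_of_le_of_card_ge h.le hle)
  rw [hm, hn] at hlt ⊢
  rw [← pow_succ']
  exact Nat.pow_le_pow_right (Fact.out : p.Prime).pos
    ((Nat.pow_lt_pow_iff_right (Fact.out : p.Prime).one_lt).1 hlt)

theorem mul_comm_of_index_center_le (hG : IsPGroup p G) (h : (Subgroup.center G).index ≤ p)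
    (a b : G) : a * b = b * a := by
  obtain ⟨n, hn⟩ := hG.index (Subgroup.center G)
  have hdvd : Nat.card (G ⧸ Subgroup.center G) ∣ p := by
    rw [← Subgroup.index_eq_card, hn]
    rw [hn] at h
    have : n ≤ 1 := (Nat.pow_le_pow_iff_right (Fact.out : p.Prime).one_lt).1 (by simpa using h)
    simpa using pow_dvd_pow p this
  have := isCyclic_of_card_dvd_prime hdvd
  have := (QuotientGroup.mk' (Subgroup.center G)).isMulCommutative_of_isCyclic_of_ker_le_center
    (by simp)
  exact mul_comm' a b

theorem mul_comm_of_card_le_sq (hG : IsPGroup p G) (h : Nat.card G ≤ p ^ 2) (a b : G) :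
    a * b = b * a := by
  rcases subsingleton_or_nontrivial G with _ | _
  · exact Subsingleton.elim _ _
  refine hG.mul_comm_of_index_center_le ?_ a b
  have := hG.center_nontrivial
  have h1 := (hG.to_subgroup (Subgroup.center G)).prime_le_card
  have h2 := (Subgroup.center G).card_mul_index
  have hp : 0 < p := (Fact.out : p.Prime).pos
  by_contra! hlt
  nlinarith

/-- In a group of order `p ^ 3` every commutator lies in every nontrivial normal
subgroup. -/
theorem commutatorElement_mem_of_card_eq_cube (hG : Nat.card G = p ^ 3) {N : Subgroup G} [N.Normal]
    (hN : N ≠ ⊥) (x y : G) : ⁅x, y⁆ ∈ N := by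
  have hpG : IsPGroup p G := .of_card hG
  have : Nontrivial N := N.nontrivial_iff_ne_bot.2 hN
  have h1 := (hpG.to_subgroup N).prime_le_card
  have h2 := N.card_mul_index
  have hp : 0 < p := (Fact.out : p.Prime).pos
  have hcard : Nat.card (G ⧸ N) ≤ p ^ 2 := by
    rw [← Subgroup.index_eq_card]
    by_contra! hlt
    rw [hG] at h2
    nlinarith [pow_pos hp 2]
  have hc := (hpG.to_quotient N).mul_comm_of_card_le_sq hcard (x : G ⧸ N) (y : G ⧸ N)
  rw [← QuotientGroup.eq_one_iff]
  change ⁅(x : G ⧸ N), (y : G ⧸ N)⁆ = 1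
  exact commutatorElement_eq_one_iff_mul_comm.2 hc

/-- For noncommuting x and y, both centralizers have index at most p, so their intersection D has
order at least p². A noncentral d in D would have an abelian centralizer, although x and y lie in
it. -/
theorem sq_le_card_center_of_card_commutator_le (hG : Nat.card G = p ^ 4)
    (hc : Nat.card (commutator G) ≤ p) : p ^ 2 ≤ Nat.card (Subgroup.center G) := by
  have hpG : IsPGroup p G := .of_card hG
  have hp : 1 < p := (Fact.out : p.Prime).one_lt
  have : Nontrivial G := Finite.one_lt_card_iff_nontrivial.1 (hG ▸ Nat.one_lt_pow (by simp) hp)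
  by_cases hab : ∀ x y : G, x * y = y * x
  · have : Subgroup.center G = ⊤ :=
      eq_top_iff.2 fun x _ => Subgroup.mem_center_iff.2 fun y => hab y x
    rw [this, Subgroup.card_top, hG]
    exact Nat.pow_le_pow_right hp.le (by simp)
  push Not at hab
  obtain ⟨x, y, hxy⟩ := hab
  let D := Subgroup.centralizer {x} ⊓ Subgroup.centralizer {y}
  have hDle : D ≤ Subgroup.center G := by
    intro d hd
    by_contra hdc
    let K := Subgroup.centralizer {d}
    have hxK : x ∈ K := Subgroup.mem_centralizer_singleton_iff.2
      (Subgroup.mem_centralizer_singleton_iff.1 hd.1).symm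
    have hyK : y ∈ K := Subgroup.mem_centralizer_singleton_iff.2
      (Subgroup.mem_centralizer_singleton_iff.1 hd.2).symm
    have hdK : d ∈ K := Subgroup.mem_centralizer_singleton_iff.2 rfl
    have hKtop : K < ⊤ := lt_top_iff_ne_top.2 fun h => hdc <| Subgroup.mem_center_iff.2 fun g =>
      Subgroup.mem_centralizer_singleton_iff.1 (h ▸ Subgroup.mem_top g : g ∈ K)
    have hKcard := hpG.prime_mul_card_le_of_lt hKtop
    rw [Subgroup.card_top, hG] at hKcard
    -- The center of K contains Z(G) and d, so its order is at least p²; as |K| ≤ p³, its index in K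
    -- is at most p.
    have hlt : Subgroup.center G < (Subgroup.center K).map K.subtype := by
      refine lt_of_le_of_ne (fun z hz => ?_) fun h => hdc ?_
      · refine ⟨⟨z, Subgroup.center_le_centralizer _ hz⟩, ?_, rfl⟩
        exact Subgroup.mem_center_iff.2 fun k => Subtype.ext (Subgroup.mem_center_iff.1 hz k)
      · rw [h]
        exact ⟨⟨d, hdK⟩, Subgroup.mem_center_iff.2 fun k =>
          Subtype.ext (Subgroup.mem_centralizer_singleton_iff.1 k.2), rfl⟩
    have hZK := hpG.prime_mul_card_le_of_lt hlt
    rw [Subgroup.card_map_of_injective K.subtype_injective] at hZK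
    have := hpG.center_nontrivial
    have hZ := (hpG.to_subgroup (Subgroup.center G)).prime_le_card
    have hidx := (Subgroup.center K).card_mul_index
    have hle : (Subgroup.center K).index ≤ p := by
      by_contra! hlt
      have h1 : p * p ≤ Nat.card (Subgroup.center K) := (Nat.mul_le_mul_left p hZ).trans hZK
      have h2 : p * p * p < Nat.card K := by
        rw [← hidx]
        exact Nat.mul_lt_mul_of_le_of_lt h1 hlt (Nat.card_pos)
      have h3 : p * (p * p * p) < p * Nat.card K := Nat.mul_lt_mul_of_pos_left h2 (by omega)
      have h4 : p * (p * p * p) = p ^ 4 := by ring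
      omega
    exact hxy (congrArg Subtype.val
      ((hpG.to_subgroup K).mul_comm_of_index_center_le hle ⟨x, hxK⟩ ⟨y, hyK⟩))
  refine le_trans ?_ (Subgroup.card_le_of_le hDle)
  have hDi : D.index ≤ p * p := Subgroup.index_inf_le.trans (Nat.mul_le_mul
    ((Subgroup.index_centralizer_singleton_le x).trans hc)
    ((Subgroup.index_centralizer_singleton_le y).trans hc))
  have hDc := D.card_mul_index
  rw [hG] at hDc
  refine Nat.le_of_mul_le_mul_right (?_ : p ^ 2 * p ^ 2 ≤ Nat.card D * p ^ 2) (by positivity)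
  rw [← pow_add, ← hDc, sq]
  exact Nat.mul_le_mul_left _ hDi

theorem exists_normal_not_commutator_le (hG : Nat.card G = p ^ 5)
    (hc : ¬ commutator G ≤ Subgroup.center G) :
    ∃ N : Subgroup G, N.Normal ∧ Nat.card N = p ^ 2 ∧ ¬ commutator G ≤ N := by
  by_contra! hno
  have hpG : IsPGroup p G := .of_card hG
  have hpp : p.Prime := Fact.out
  have hp : 1 < p := hpp.one_lt
  have : Nontrivial G := Finite.one_lt_card_iff_nontrivial.1 (hG ▸ Nat.one_lt_pow (by simp) hp)
  set Z := Subgroup.center G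
  have hZcard : Nat.card Z = p := by
    obtain ⟨n, hn⟩ := IsPGroup.iff_card.1 (hpG.to_subgroup Z)
    have := hpG.center_nontrivial
    have h1 := (hpG.to_subgroup Z).prime_le_card
    have hn1 : 1 ≤ n := by
      rw [hn] at h1
      exact (Nat.pow_le_pow_iff_right hp).1 (by simpa using h1)
    -- Otherwise a subgroup of order p² in the center is normal, hence contains G', making G'
    -- central.
    have hn2 : n < 2 := by
      by_contra! h2
      obtain ⟨S, hS⟩ := Sylow.exists_subgroup_card_pow_prime (G := Z) p
        (hn ▸ pow_dvd_pow p h2 : p ^ 2 ∣ Nat.card Z)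
      have hSZ : S.map Z.subtype ≤ Z := Subgroup.map_subtype_le S
      exact hc ((hno _ (Subgroup.normal_of_le_center hSZ)
        (by rw [Subgroup.card_map_of_injective Z.subtype_injective, hS])).trans hSZ)
    obtain rfl : n = 1 := by omega
    simpa using hn
  let π := QuotientGroup.mk' Z
  have hQ : Nat.card (G ⧸ Z) = p ^ 4 := by
    have := Z.card_mul_index
    rw [hG, hZcard, Subgroup.index_eq_card] at this
    exact Nat.eq_of_mul_eq_mul_left hpp.pos (this.trans (by ring))
  have hpQ : IsPGroup p (G ⧸ Z) := .of_card hQ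
  have hle_of_card : ∀ S : Subgroup (G ⧸ Z), S ≤ Subgroup.center (G ⧸ Z) → Nat.card S = p →
      commutator G ≤ S.comap π := fun S hS hcard =>
    hno _ ((Subgroup.normal_of_le_center hS).comap π)
      (by rw [Subgroup.card_comap_mk', hZcard, hcard, sq])
  have : Nontrivial (G ⧸ Z) :=
    Finite.one_lt_card_iff_nontrivial.1 (hQ ▸ Nat.one_lt_pow (by simp) hp)
  obtain ⟨S, hScard, hS⟩ : ∃ S : Subgroup (G ⧸ Z), Nat.card S = p ∧
      S ≤ Subgroup.center (G ⧸ Z) := by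
    have := hpQ.center_nontrivial
    obtain ⟨S, hS⟩ := Sylow.exists_subgroup_card_pow_prime (n := 1)
      (G := Subgroup.center (G ⧸ Z)) p (by
        rw [pow_one]
        exact (hpQ.to_subgroup _).card_eq_or_dvd.resolve_left Finite.one_lt_card.ne')
    exact ⟨S.map (Subgroup.subtype _), by
      rw [Subgroup.card_map_of_injective (Subgroup.subtype_injective _), hS, pow_one],
      Subgroup.map_subtype_le S⟩
  have hcomm : commutator (G ⧸ Z) ≤ S := by
    have h : commutator (G ⧸ Z) = (commutator G).map π := by
      rw [commutator_def, commutator_def, Subgroup.map_commutator,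
        Subgroup.map_top_of_surjective _ (QuotientGroup.mk'_surjective Z)]
    rw [h, Subgroup.map_le_iff_le_comap]
    exact hle_of_card S hS hScard
  have hcenter := sq_le_card_center_of_card_commutator_le hQ
    ((Subgroup.card_le_of_le hcomm).trans hScard.le)
  obtain ⟨q, hq, hqS⟩ : ∃ q ∈ Subgroup.center (G ⧸ Z), q ∉ S := by
    by_contra! h
    have h1 := hcenter.trans ((Subgroup.card_le_of_le h).trans hScard.le)
    nlinarith
  obtain ⟨z, rfl⟩ := QuotientGroup.mk_surjective q
  -- The commutator of z with any g lies in Z, which has order p, so conjugation by g fixes z ^ p.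
  -- Hence z has order p modulo Z and generates the second central subgroup.
  have hzp : z ^ p ∈ Z := by
    refine Subgroup.mem_center_iff.2 fun g => ?_
    have hw : z⁻¹ * (g * z * g⁻¹) ∈ Z := by
      rw [← QuotientGroup.eq, QuotientGroup.mk_mul, QuotientGroup.mk_mul, QuotientGroup.mk_inv,
        Subgroup.mem_center_iff.1 hq, mul_inv_cancel_right]
    have hwp : (z⁻¹ * (g * z * g⁻¹)) ^ p = 1 := by
      have := pow_card_eq_one' (x := (⟨_, hw⟩ : Z))
      rw [hZcard] at this
      exact congrArg Subtype.val this
    have hcom : Commute z (z⁻¹ * (g * z * g⁻¹)) := Subgroup.mem_center_iff.1 hw z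
    have : g * z ^ p * g⁻¹ = z ^ p := by
      rw [← conj_pow]
      calc (g * z * g⁻¹) ^ p = (z * (z⁻¹ * (g * z * g⁻¹))) ^ p := by rw [mul_inv_cancel_left]
        _ = z ^ p := by rw [hcom.mul_pow, hwp, mul_one]
    rwa [mul_inv_eq_iff_eq_mul] at this
  have hz1 : (z : G ⧸ Z) ≠ 1 := fun h => hqS (h ▸ one_mem S)
  have hzcard : Nat.card (Subgroup.zpowers (z : G ⧸ Z)) = p := by
    rw [Nat.card_zpowers]
    exact orderOf_eq_prime (by rw [← QuotientGroup.mk_pow]; exact (QuotientGroup.eq_one_iff _).2 hzp)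
      hz1
  have hinf : S ⊓ Subgroup.zpowers (z : G ⧸ Z) = ⊥ := by
    by_contra hne
    have := (Subgroup.nontrivial_iff_ne_bot _).2 hne
    have h1 := (hpQ.to_subgroup (S ⊓ Subgroup.zpowers (z : G ⧸ Z))).prime_le_card
    have h2 := Subgroup.eq_of_le_of_card_ge (inf_le_right : S ⊓ Subgroup.zpowers (z : G ⧸ Z) ≤ _)
      (hzcard.le.trans h1)
    exact hqS ((inf_eq_right.1 h2) (Subgroup.mem_zpowers _))
  refine hc ?_
  have := le_inf (hle_of_card S hS hScard)
    (hle_of_card (Subgroup.zpowers (z : G ⧸ Z)) ((Subgroup.zpowers_le).2 hq) hzcard)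
  rwa [← Subgroup.comap_inf, hinf, MonoidHom.comap_bot, QuotientGroup.ker_mk'] at this

end IsPGroup

/-! ### Nonabelian groups of order p³ and the conclusion -/

/-- A nonabelian group of order `p ^ 3` has a faithful irreducible character of degree `p`. -/
theorem prime_sq_mem_cod_of_card_eq_cube {p : ℕ} [Fact p.Prime] {G : Type*} [Group G] [Finite G]
    (hG : Nat.card G = p ^ 3) {x y : G} (hxy : x * y ≠ y * x) : (p : ℂ) ^ 2 ∈ cod G := by
  have hpG : IsPGroup p G := .of_card hG
  have hp : 1 < p := (Fact.out : p.Prime).one_lt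
  have : Nontrivial G := Finite.one_lt_card_iff_nontrivial.1 (hG ▸ Nat.one_lt_pow (by simp) hp)
  have hne : ⁅x, y⁆ ≠ 1 := fun h => hxy (commutatorElement_eq_one_iff_mul_comm.1 h)
  obtain ⟨V, _, _, _, ρ, hρ, hρc⟩ := Representation.exists_isIrreducible_apply_ne_one hne
  have hker : MonoidHom.ker ρ = ⊥ := by
    by_contra h
    exact hρc (IsPGroup.commutatorElement_mem_of_card_eq_cube hG h x y)
  set Z := Subgroup.center G
  have hcZ : ⁅x, y⁆ ∈ Z :=
    IsPGroup.commutatorElement_mem_of_card_eq_cube hG hpG.bot_lt_center.ne' x y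
  have hpZ : p ≤ Nat.card Z :=
    have := hpG.center_nontrivial
    (hpG.to_subgroup Z).prime_le_card
  have hZcard : Nat.card Z = p := by
    obtain ⟨n, hn⟩ := IsPGroup.iff_card.1 (hpG.to_subgroup Z)
    have hn1 : 1 ≤ n := by
      rw [hn] at hpZ
      exact (Nat.pow_le_pow_iff_right hp).1 (by simpa using hpZ)
    have hn2 : n < 2 := by
      by_contra! h2
      refine hxy (hpG.mul_comm_of_index_center_le ?_ x y)
      have h3 := Z.card_mul_index
      have h4 : p ^ 2 ≤ Nat.card Z := hn ▸ Nat.pow_le_pow_right hp.le h2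
      refine Nat.le_of_mul_le_mul_left (?_ : p ^ 2 * Z.index ≤ p ^ 2 * p) (by positivity)
      rw [← pow_succ, ← hG, ← h3]
      exact Nat.mul_le_mul_right _ h4
    obtain rfl : n = 1 := by omega
    simpa using hn
  have := hρ.nontrivial
  obtain ⟨μ, hμ⟩ := hρ.exists_eq_smul_of_mem_center hcZ
  have hμ1 : μ ≠ 1 := fun h => hρc (LinearMap.ext fun v => by rw [hμ, h, one_smul]; rfl)
  have hμp : μ ^ p = 1 := by
    have h1 : ⁅x, y⁆ ^ p = 1 := by
      have := pow_card_eq_one' (x := (⟨_, hcZ⟩ : Z))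
      rw [hZcard] at this
      exact congrArg Subtype.val this
    have h2 : ρ ⁅x, y⁆ = μ • (1 : V →ₗ[ℂ] V) := LinearMap.ext hμ
    have h3 : (μ ^ p) • (1 : V →ₗ[ℂ] V) = 1 := by
      rw [← one_pow (M := V →ₗ[ℂ] V) p, ← smul_pow, ← h2, ← map_pow, h1, map_one, one_pow]
    obtain ⟨v, hv⟩ := exists_ne (0 : V)
    have h4 : (μ ^ p) • v = (1 : ℂ) • v := by
      rw [one_smul]
      exact LinearMap.congr_fun h3 v
    exact smul_left_injective ℂ hv h4
  have hdvd := Representation.dvd_finrank_of_commutator_eq_smul hμ hμp hμ1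
  -- The subgroup generated by Z and y preserves the line of an eigenvector of y and has index at
  -- most p, which bounds the degree.
  obtain ⟨ν, hν⟩ := Module.End.exists_eigenvalue (ρ y)
  obtain ⟨v, hv⟩ := hν.exists_hasEigenvector
  have hy : y ∉ Z := fun h => hxy (Subgroup.mem_center_iff.1 h x)
  have hle : Module.finrank ℂ V ≤ p := by
    have hlt : Z < Z ⊔ Subgroup.zpowers y :=
      lt_of_le_of_ne le_sup_left fun h =>
        hy (h ▸ (le_sup_right : _ ≤ Z ⊔ Subgroup.zpowers y) (Subgroup.mem_zpowers y))
    have h1 := hpG.prime_mul_card_le_of_lt hlt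
    have h2 : Module.finrank ℂ V ≤ (Z ⊔ Subgroup.zpowers y).index := by
      -- A submonoid suffices: in a finite group the powers of y already include its inverse.
      let A : Submonoid G :=
        { carrier := {a | ∃ μ : ℂ, ρ a v = μ • v}
          one_mem' := ⟨1, by simp⟩
          mul_mem' := by
            rintro a b ⟨α, ha⟩ ⟨β, hb⟩
            exact ⟨β * α, by rw [map_mul, Module.End.mul_apply, hb, map_smul, ha, mul_smul]⟩ }
      refine hρ.finrank_le_index hv.2 fun a ha => (?_ : a ∈ A)
      have hyA : y ∈ A := ⟨ν, hv.apply_eq_smul⟩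
      obtain ⟨c, hc, b, hb, rfl⟩ := Subgroup.mem_sup_of_normal_left.1 ha
      obtain ⟨k, rfl⟩ := mem_powers_iff_mem_zpowers.2 hb
      refine mul_mem ?_ (pow_mem hyA k)
      obtain ⟨α, hα⟩ := hρ.exists_eq_smul_of_mem_center hc
      exact ⟨α, hα v⟩
    refine h2.trans ?_
    have h3 := (Z ⊔ Subgroup.zpowers y).card_mul_index
    rw [hZcard] at h1
    refine Nat.le_of_mul_le_mul_left (?_ : p * p * _ ≤ p * p * p) (by positivity)
    calc p * p * (Z ⊔ Subgroup.zpowers y).index ≤ p ^ 3 :=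
        hG ▸ h3 ▸ Nat.mul_le_mul_right _ h1
      _ = p * p * p := by ring
  have hfin : Module.finrank ℂ V = p :=
    le_antisymm hle (Nat.le_of_dvd Module.finrank_pos hdvd)
  have hmem := hρ.index_ker_div_finrank_mem_cod
  have hp0 : (p : ℂ) ≠ 0 := by exact_mod_cast (by omega : p ≠ 0)
  rw [hker, Subgroup.index_bot, hG, hfin] at hmem
  convert hmem using 1
  push_cast
  field_simp

theorem mainTheorem5 (p : ℕ) (hp : p.Prime) (G : Type*) [Group G] (hG : Nat.card G = p ^ 5)
    (hclass : 3 ≤ Group.nilpotencyClass G) : (p : ℂ) ^ 2 ∈ cod G := by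
  have := Fact.mk hp
  have : Finite G := Nat.finite_of_card_ne_zero (hG ▸ pow_ne_zero 5 hp.ne_zero)
  have := (IsPGroup.of_card hG).isNilpotent
  have hc : ¬ commutator G ≤ Subgroup.center G := by
    intro h
    have h2 : (⊤ : Subgroup G).lowerCentralSeries 2 = ⊥ := by
      rw [Subgroup.lowerCentralSeries_succ, Subgroup.top_lowerCentralSeries_one]
      exact Subgroup.commutator_top_right_eq_bot_iff_le_center.2 h
    have := Subgroup.lowerCentralSeries_eq_bot_iff_nilpotencyClass_le.1 h2
    omega
  obtain ⟨N, _, hN, hcN⟩ := IsPGroup.exists_normal_not_commutator_le hG hc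
  have hQ : Nat.card (G ⧸ N) = p ^ 3 := by
    have := N.card_mul_index
    rw [hG, hN, Subgroup.index_eq_card] at this
    exact Nat.eq_of_mul_eq_mul_left (pow_pos hp.pos 2) (this.trans (by ring))
  refine cod_subset_of_surjective (QuotientGroup.mk'_surjective N) ?_
  by_contra hcod
  refine hcN ?_
  rw [commutator_def, Subgroup.commutator_le]
  intro x _ y _
  rw [← QuotientGroup.eq_one_iff]
  change ⁅(x : G ⧸ N), (y : G ⧸ N)⁆ = 1
  refine commutatorElement_eq_one_iff_mul_comm.2 ?_
  by_contra hxy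
  exact hcod (prime_sq_mem_cod_of_card_eq_cube hQ hxy)
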